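/- Let $p\ge 2$ be an integer and let $X=\ell_p^2(\mathbb{R})$, i.e. $\mathbb{R}^2$ with the norm $\|(x_1,x_2)\|=(|x_1|^p+|x_2|^p)^{1/p}$. For a bounded linear operator $T:X\to X$ with operator norm $\|T\|$, let $M_T=\{x\in X:\ \|x\|=1,\ \|Tx\|=\|T\|\}$ be its norm attainment set. If $T$ is not a scalar multiple of a linear isometry of $X$, then $M_T$ is finite and its cardinality satisfies $|M_T|\le 4(4p-3)$. -/

import Mathlib

open scoped ENNReal

/-- The norm attainment set `M_T` of a bounded linear operator `T`: all unit vectors at which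
`T` attains its operator norm. -/
def normAttainmentSet {𝕜 X Y : Type*} [RCLike 𝕜] [NormedAddCommGroup X] [NormedSpace 𝕜 X]
    [NormedAddCommGroup Y] [NormedSpace 𝕜 Y] (T : X →L[𝕜] Y) : Set X :=
  {x | ‖x‖ = 1 ∧ ‖T x‖ = ‖T‖}

/-- `T` is a scalar multiple of an isometry: `T = c U` with `c` a scalar (possibly `0`) and `U` a
linear isometry. -/
def IsScalarMultipleOfIsometry {𝕜 X Y : Type*} [RCLike 𝕜] [NormedAddCommGroup X]
    [NormedSpace 𝕜 X] [NormedAddCommGroup Y] [NormedSpace 𝕜 Y] (T : X →L[𝕜] Y) : Prop :=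
  ∃ (c : 𝕜) (U : X →ₗᵢ[𝕜] Y), T = c • U.toContinuousLinearMap

/-! Let `N = ‖T‖ ^ p`. Then `F(x, y) = |a x + b y| ^ p + |c x + d y| ^ p - N (|x| ^ p + |y| ^ p)` is
nonpositive and vanishes on `M_T`. Off the axes put `t = x / y` and replace the absolute values by
the signs they have at `t`. The resulting polynomial vanishes at `t` and is at most `F(·, 1) ≤ 0`
nearby, so `t` is a critical point (`eval_derivative_powerDefect_eq_zero`). If its derivative is
zero, so is the polynomial, and its coefficients make `T` a multiple of an isometry
(`abs_pow_add_abs_pow_eq_of_powerDefect_eq_zero`). Otherwise there are at most `p - 1` roots for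
each of 8 sign patterns, two unit vectors per root and four on the axes: `4 + 16 (p - 1) = 4 (4 p -
3)`. -/

open Polynomial in
/-- The polynomial `(a t + b) ^ p + (c t + d) ^ p - N ((s t) ^ p + 1)` in the variable `t`. -/
noncomputable def powerDefect (p : ℕ) (N a b c d s : ℝ) : ℝ[X] :=
  (C a * X + C b) ^ p + (C c * X + C d) ^ p - C N * ((C s * X) ^ p + 1)

section PowerDefect

open Polynomial

theorem eval_powerDefect (p : ℕ) (N a b c d s t : ℝ) :
    (powerDefect p N a b c d s).eval t =
      (a * t + b) ^ p + (c * t + d) ^ p - N * ((s * t) ^ p + 1) := by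
  simp [powerDefect]

theorem natDegree_powerDefect_le (p : ℕ) (N a b c d s : ℝ) :
    (powerDefect p N a b c d s).natDegree ≤ p := by
  unfold powerDefect
  compute_degree

theorem coeff_C_mul_X_add_C_pow (a b : ℝ) (n k : ℕ) :
    ((C a * X + C b) ^ n).coeff k = a ^ k * b ^ (n - k) * (n.choose k : ℝ) := by
  have h : (C a * X + C b) ^ n = ((X + C b) ^ n).comp (C a * X) := by simp
  rw [h, comp_C_mul_X_coeff, coeff_X_add_C_pow]
  ring

theorem coeff_powerDefect (p k : ℕ) (N a b c d s : ℝ) :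
    (powerDefect p N a b c d s).coeff k =
      (a ^ k * b ^ (p - k) + c ^ k * d ^ (p - k)) * (p.choose k : ℝ)
        - N * ((if k = p then s ^ p else 0) + if k = 0 then 1 else 0) := by
  simp only [powerDefect, coeff_sub, coeff_add, coeff_C_mul_X_add_C_pow, coeff_C_mul, mul_pow,
    ← C_pow, coeff_X_pow, coeff_one]
  split_ifs <;> ring

/-- If the coefficients of `(a t + b) ^ p + (c t + d) ^ p` at `t ^ (p - 1)` and `t ^ (p - 2)`
vanish, but the extreme ones do not, then `(a, b; c, d)` is diagonal or antidiagonal. -/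
theorem diagonal_or_antidiagonal {m : ℕ} {a b c d : ℝ}
    (h₀ : b ^ (m + 2) + d ^ (m + 2) ≠ 0) (h₃ : a ^ (m + 2) + c ^ (m + 2) ≠ 0)
    (h₁ : a ^ (m + 1) * b + c ^ (m + 1) * d = 0) (h₂ : a ^ m * b ^ 2 + c ^ m * d ^ 2 = 0) :
    b = 0 ∧ c = 0 ∨ a = 0 ∧ d = 0 := by
  rcases eq_or_ne c 0 with rfl | hc
  · have : a ≠ 0 := by
      rintro rfl
      simp at h₃
    simp [this] at h₁
    simp [h₁]
  rcases eq_or_ne d 0 with rfl | hd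
  · have : b ≠ 0 := by
      rintro rfl
      simp at h₀
    simp [this] at h₁
    simp [h₁]
  -- With `c` and `d` nonzero, the two vanishing coefficients force a zero determinant, which then
  -- kills the top coefficient.
  have hdet : a * d = c * b := by
    have : (c ^ m * d) * (a * d - c * b) = 0 := by linear_combination a * h₂ - b * h₁
    have := (mul_eq_zero.1 this).resolve_left (by positivity)
    linarith
  refine absurd ?_ h₃
  have : d * (a ^ (m + 2) + c ^ (m + 2)) = 0 := by
    linear_combination c * h₁ + a ^ (m + 1) * hdet
  exact (mul_eq_zero.1 this).resolve_left hd

/-- For `p ≥ 3` the matrix is diagonal or antidiagonal, and the extreme coefficients fix the moduli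
of its entries. -/
theorem abs_pow_add_abs_pow_eq_of_powerDefect_eq_zero {p : ℕ} (hp : 2 ≤ p) {N a b c d s : ℝ}
    (hN : 0 < N) (hs : |s| = 1) (h : powerDefect p N a b c d s = 0) (x y : ℝ) :
    |a * x + b * y| ^ p + |c * x + d * y| ^ p = N * (|x| ^ p + |y| ^ p) := by
  obtain ⟨m, rfl⟩ := Nat.exists_eq_add_of_le' hp
  have hcoeff (k : ℕ) :=
    (coeff_powerDefect (m + 2) k N a b c d s).symm.trans (by rw [h, coeff_zero])
  have h0 : b ^ (m + 2) + d ^ (m + 2) = N := by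
    have := hcoeff 0
    simp at this
    linarith
  have htop : a ^ (m + 2) + c ^ (m + 2) = N * s ^ (m + 2) := by
    have := hcoeff (m + 2)
    simp at this
    linarith
  have h1 : a ^ (m + 1) * b + c ^ (m + 1) * d = 0 := by
    have := hcoeff (m + 1)
    have hch : ((m + 2).choose (m + 1) : ℝ) ≠ 0 :=
      Nat.cast_ne_zero.2 (Nat.choose_pos (by omega)).ne'
    have hsub : m + 2 - (m + 1) = 1 := by omega
    rw [hsub, if_neg (by omega), if_neg (by omega)] at this
    simpa only [pow_one, add_zero, mul_zero, sub_zero, mul_eq_zero, hch, or_false] using this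
  rcases eq_or_ne m 0 with rfl | hm
  -- For `p = 2` the coefficient at `t ^ (p - 2)` is the constant one and gives nothing new;
  -- rotations do occur, and expanding the squares suffices.
  · have hs2 : s ^ 2 = 1 := by rw [← sq_abs, hs, one_pow]
    simp only [zero_add, sq_abs, pow_one, hs2] at *
    linear_combination x ^ 2 * htop + y ^ 2 * h0 + 2 * x * y * h1
  have h2 : a ^ m * b ^ 2 + c ^ m * d ^ 2 = 0 := by
    have := hcoeff m
    have hch : ((m + 2).choose m : ℝ) ≠ 0 :=
      Nat.cast_ne_zero.2 (Nat.choose_pos (by omega)).ne'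
    simpa [hch, hm] using this
  have hs0 : s ≠ 0 := by
    rintro rfl
    simp at hs
  have hne : N * s ^ (m + 2) ≠ 0 := mul_ne_zero hN.ne' (pow_ne_zero _ hs0)
  have habs0 := congrArg abs h0
  have habs1 := congrArg abs htop
  rcases diagonal_or_antidiagonal (h0.trans_ne hN.ne') (htop.trans_ne hne) h1 h2 with
    ⟨rfl, rfl⟩ | ⟨rfl, rfl⟩ <;>
  · simp [abs_mul, mul_pow, abs_pow, hs, abs_of_pos hN] at habs0 habs1 ⊢
    rw [habs0, habs1]
    ring

/-- At a zero of the nonpositive function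
`|a t + b| ^ p + |c t + d| ^ p - N (|t| ^ p + 1)` other than the origin, the polynomial that
agrees with the function near that point from below has a critical point. -/
theorem eval_derivative_powerDefect_eq_zero {p : ℕ} {N a b c d s₁ s₂ s₃ t : ℝ}
    (h : ∀ x y, |a * x + b * y| ^ p + |c * x + d * y| ^ p ≤ N * (|x| ^ p + |y| ^ p))
    (hs₁ : |s₁| = 1) (hs₂ : |s₂| = 1) (hs₃ : |s₃| = 1) (hpos : 0 < s₃ * t)
    (ht : (powerDefect p N (s₁ * a) (s₁ * b) (s₂ * c) (s₂ * d) s₃).eval t = 0) :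
    (powerDefect p N (s₁ * a) (s₁ * b) (s₂ * c) (s₂ * d) s₃).derivative.eval t = 0 := by
  refine IsLocalMax.hasDerivAt_eq_zero ?_ (Polynomial.hasDerivAt _ t)
  -- Only the subtracted term needs its sign to persist near `t`; for the other two, `u ^ p ≤ |u| ^
  -- p` is enough even where they change sign.
  have hnear : ∀ᶠ r in nhds t, 0 < s₃ * r :=
    (continuous_const.mul continuous_id).continuousAt.eventually_const_lt hpos
  have hle {s : ℝ} (hs : |s| = 1) (u v r : ℝ) : (s * u * r + s * v) ^ p ≤ |u * r + v| ^ p := by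
    have : |s * u * r + s * v| = |u * r + v| := by
      rw [← one_mul |u * r + v|, ← hs, ← abs_mul]
      ring_nf
    rw [← this, ← abs_pow]
    exact le_abs_self _
  filter_upwards [hnear] with r hr
  have habs : |r| = s₃ * r := by rw [← abs_of_pos hr, abs_mul, hs₃, one_mul]
  have hr1 := h r 1
  rw [ht, eval_powerDefect]
  simp only [mul_one, abs_one, one_pow, habs] at hr1
  linarith [hle hs₁ a b r, hle hs₂ c d r]

/-- The critical points of all the polynomials `powerDefect` obtained by choosing signs. -/
noncomputable def criticalSlopes (p : ℕ) (N a b c d : ℝ) : Finset ℝ :=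
  (Finset.univ : Finset (ℤˣ × ℤˣ × ℤˣ)).biUnion fun s =>
    (powerDefect p N ((s.1 : ℤ) * a) ((s.1 : ℤ) * b) ((s.2.1 : ℤ) * c) ((s.2.1 : ℤ) * d)
      (s.2.2 : ℤ)).derivative.roots.toFinset

theorem card_criticalSlopes_le (p : ℕ) (N a b c d : ℝ) :
    (criticalSlopes p N a b c d).card ≤ 8 * (p - 1) := by
  refine (Finset.card_biUnion_le_card_mul _ _ (p - 1) fun s _ => ?_).trans ?_
  · exact (Multiset.toFinset_card_le _).trans <| (card_roots' _).trans <|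
      (natDegree_derivative_le _).trans (Nat.sub_le_sub_right (natDegree_powerDefect_le ..) 1)
  · simp

theorem abs_intUnit_cast (s : ℤˣ) : |((s : ℤ) : ℝ)| = 1 := by
  rcases Int.units_eq_one_or s with rfl | rfl <;> simp

theorem exists_intUnit_mul_eq_abs (x : ℝ) : ∃ s : ℤˣ, ((s : ℤ) : ℝ) * x = |x| := by
  rcases abs_choice x with h | h
  · exact ⟨1, by simp [h]⟩
  · exact ⟨-1, by simp [h]⟩

theorem mem_criticalSlopes {p : ℕ} (hp : 2 ≤ p) {N a b c d t : ℝ} (hN : 0 < N)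
    (h : ∀ x y, |a * x + b * y| ^ p + |c * x + d * y| ^ p ≤ N * (|x| ^ p + |y| ^ p))
    (hne : ¬ ∀ x y, |a * x + b * y| ^ p + |c * x + d * y| ^ p = N * (|x| ^ p + |y| ^ p))
    (ht0 : t ≠ 0) (ht : |a * t + b| ^ p + |c * t + d| ^ p = N * (|t| ^ p + 1)) :
    t ∈ criticalSlopes p N a b c d := by
  obtain ⟨s₁, h₁⟩ := exists_intUnit_mul_eq_abs (a * t + b)
  obtain ⟨s₂, h₂⟩ := exists_intUnit_mul_eq_abs (c * t + d)
  obtain ⟨s₃, h₃⟩ := exists_intUnit_mul_eq_abs t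
  have heval : (powerDefect p N ((s₁ : ℤ) * a) ((s₁ : ℤ) * b) ((s₂ : ℤ) * c) ((s₂ : ℤ) * d)
      (s₃ : ℤ)).eval t = 0 := by
    rw [eval_powerDefect, mul_assoc, ← mul_add, mul_assoc, ← mul_add, h₁, h₂, h₃, ht, sub_self]
  have hcrit := eval_derivative_powerDefect_eq_zero h (abs_intUnit_cast s₁) (abs_intUnit_cast s₂)
    (abs_intUnit_cast s₃) (h₃ ▸ abs_pos.2 ht0) heval
  refine Finset.mem_biUnion.2 ⟨(s₁, s₂, s₃), Finset.mem_univ _, ?_⟩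
  rw [Multiset.mem_toFinset, mem_roots']
  refine ⟨fun hder => hne fun x y => ?_, hcrit⟩
  -- A constant polynomial with the zero `t` is zero.
  have hzero := eq_C_of_derivative_eq_zero hder
  rw [hzero, eval_C] at heval
  rw [heval, C_0] at hzero
  have := abs_pow_add_abs_pow_eq_of_powerDefect_eq_zero hp hN (abs_intUnit_cast s₃) hzero x y
  simpa only [mul_assoc, ← mul_add, abs_mul, abs_intUnit_cast, one_mul] using this

end PowerDefect

section LpPlane

/-- The plane with the `ℓ^p` norm. -/
abbrev LpPlane (p : ℕ) : Type := PiLp (p : ℝ≥0∞) (fun _ : Fin 2 => ℝ)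

theorem norm_pow_lpPlane {p : ℕ} [Fact (1 ≤ (p : ℝ≥0∞))] (hp : p ≠ 0) (v : LpPlane p) : ‖v‖ ^ p = |v 0| ^ p + |v 1| ^ p := by
  rw [PiLp.norm_eq_of_nat p rfl, ← Real.rpow_natCast, ← Real.rpow_mul (by positivity),
    one_div_mul_cancel (Nat.cast_ne_zero.2 hp), Real.rpow_one]
  simp

theorem map_apply_lpPlane {p : ℕ} (T : LpPlane p →L[ℝ] LpPlane p) (v : LpPlane p) (i : Fin 2) :
    T v i = T (PiLp.single _ 0 1) i * v 0 + T (PiLp.single _ 1 1) i * v 1 := by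
  have hv : v = v 0 • PiLp.single (p : ℝ≥0∞) (0 : Fin 2) (1 : ℝ) +
      v 1 • PiLp.single (p : ℝ≥0∞) (1 : Fin 2) (1 : ℝ) := by
    ext j
    fin_cases j <;> simp
  conv_lhs => rw [hv]
  simp [mul_comm]

theorem isScalarMultipleOfIsometry_of_norm_map {X Y : Type*} [NormedAddCommGroup X]
    [NormedSpace ℝ X] [NormedAddCommGroup Y] [NormedSpace ℝ Y] (T : X →L[ℝ] Y) (hT : ‖T‖ ≠ 0)
    (h : ∀ v, ‖T v‖ = ‖T‖ * ‖v‖) : IsScalarMultipleOfIsometry T := by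
  refine ⟨‖T‖, ⟨(‖T‖⁻¹ • T).toLinearMap, fun v => ?_⟩, ?_⟩
  · simp [norm_smul, h, hT]
  · ext v
    simp [smul_smul, hT]

open Classical in
/-- The unit vectors on the coordinate axes, and those on the lines `x = t y` for `t ∈ S`. -/
noncomputable def candidates (p : ℕ) [Fact (1 ≤ (p : ℝ≥0∞))] (S : Finset ℝ) :
    Finset (LpPlane p) :=
  (Finset.univ : Finset (ℤˣ × Fin 2)).image
      (fun q => (PiLp.single _ q.2 ((q.1 : ℤ) : ℝ) : LpPlane p)) ∪
    ((Finset.univ : Finset ℤˣ) ×ˢ S).image fun q =>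
      ((q.1 : ℤ) : ℝ) • ‖(WithLp.toLp _ ![q.2, 1] : LpPlane p)‖⁻¹ •
        (WithLp.toLp _ ![q.2, 1] : LpPlane p)

theorem card_candidates_le {p : ℕ} [Fact (1 ≤ (p : ℝ≥0∞))] (S : Finset ℝ) :
    (candidates p S).card ≤ 4 + 2 * S.card := by
  classical
  refine (Finset.card_union_le _ _).trans (add_le_add ?_ ?_)
  · exact Finset.card_image_le
  · exact Finset.card_image_le.trans (by simp)

theorem mem_candidates {p : ℕ} [Fact (1 ≤ (p : ℝ≥0∞))] (hp : p ≠ 0) {S : Finset ℝ}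
    {v : LpPlane p} (hv : ‖v‖ = 1)
    (h : v 0 ≠ 0 → v 1 ≠ 0 → v 0 / v 1 ∈ S) : v ∈ candidates p S := by
  classical
  have hnorm := norm_pow_lpPlane hp v
  rw [hv, one_pow] at hnorm
  have hunit {x : ℝ} (hx : 1 = |x| ^ p) : ∃ s : ℤˣ, ((s : ℤ) : ℝ) = x := by
    have : |x| = 1 := (pow_eq_one_iff_of_nonneg (abs_nonneg x) hp).1 hx.symm
    rcases (abs_eq zero_le_one).1 this with rfl | rfl
    · exact ⟨1, by simp⟩
    · exact ⟨-1, by simp⟩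
  unfold candidates
  rw [Finset.mem_union, Finset.mem_image, Finset.mem_image]
  rcases eq_or_ne (v 0) 0 with h0 | h0
  · obtain ⟨s, hs⟩ := hunit (x := v 1) (by simpa [h0, hp] using hnorm)
    refine Or.inl ⟨(s, 1), Finset.mem_univ _, ?_⟩
    ext j
    fin_cases j <;> simp [h0, hs]
  rcases eq_or_ne (v 1) 0 with h1 | h1
  · obtain ⟨s, hs⟩ := hunit (x := v 0) (by simpa [h1, hp] using hnorm)
    refine Or.inl ⟨(s, 0), Finset.mem_univ _, ?_⟩
    ext j
    fin_cases j <;> simp [h1, hs]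
  obtain ⟨s, hs⟩ := exists_intUnit_mul_eq_abs (v 1)
  refine Or.inr ⟨(s, v 0 / v 1), Finset.mem_product.2 ⟨Finset.mem_univ _, h h0 h1⟩, ?_⟩
  set w : LpPlane p := WithLp.toLp _ ![v 0 / v 1, 1] with hw
  have hvw : v = v 1 • w := by
    ext j
    fin_cases j <;> simp [hw, mul_div_cancel₀ _ h1]
  -- Since `v = v 1 • w` is a unit vector, its slope determines it up to sign.
  have hwn : ‖w‖⁻¹ = |v 1| := by
    rw [hvw, norm_smul, Real.norm_eq_abs] at hv
    exact (eq_inv_of_mul_eq_one_left hv).symm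
  have hss : ((s : ℤ) : ℝ) * ((s : ℤ) : ℝ) = 1 := by
    rw [← abs_mul_abs_self, abs_intUnit_cast, one_mul]
  change ((s : ℤ) : ℝ) • ‖w‖⁻¹ • w = v
  rw [hwn, ← hs, smul_smul, ← mul_assoc, hss, one_mul, ← hvw]

end LpPlane

theorem mainTheorem12 (p : ℕ) (hp : 2 ≤ p) [Fact (1 ≤ (p : ℝ≥0∞))]
    (T : PiLp (p : ℝ≥0∞) (fun _ : Fin 2 => ℝ) →L[ℝ] PiLp (p : ℝ≥0∞) (fun _ : Fin 2 => ℝ))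
    (hT : ¬ IsScalarMultipleOfIsometry T) :
    (normAttainmentSet T).Finite ∧ (normAttainmentSet T).ncard ≤ 4 * (4 * p - 3) := by
  have hp0 : p ≠ 0 := by omega
  have hT0 : ‖T‖ ≠ 0 := fun h => hT ⟨0, LinearIsometry.id, by simpa using h⟩
  have hN : 0 < ‖T‖ ^ p := by positivity
  set e : Fin 2 → PiLp (p : ℝ≥0∞) (fun _ : Fin 2 => ℝ) := fun i => PiLp.single _ i 1
  have hTv (v) : ‖T v‖ ^ p =
      |T (e 0) 0 * v 0 + T (e 1) 0 * v 1| ^ p + |T (e 0) 1 * v 0 + T (e 1) 1 * v 1| ^ p := by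
    rw [norm_pow_lpPlane hp0, map_apply_lpPlane T v 0, map_apply_lpPlane T v 1]
  have hle (x y : ℝ) : |T (e 0) 0 * x + T (e 1) 0 * y| ^ p + |T (e 0) 1 * x + T (e 1) 1 * y| ^ p ≤
      ‖T‖ ^ p * (|x| ^ p + |y| ^ p) := by
    have h := pow_le_pow_left₀ (norm_nonneg _) (T.le_opNorm (WithLp.toLp _ ![x, y])) p
    rw [mul_pow, hTv, norm_pow_lpPlane hp0] at h
    simpa using h
  have hne : ¬ ∀ x y : ℝ, |T (e 0) 0 * x + T (e 1) 0 * y| ^ p +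
      |T (e 0) 1 * x + T (e 1) 1 * y| ^ p = ‖T‖ ^ p * (|x| ^ p + |y| ^ p) := fun h =>
    hT <| isScalarMultipleOfIsometry_of_norm_map T hT0 fun v =>
      (pow_left_inj₀ (norm_nonneg _) (by positivity) hp0).1 <| by
        rw [hTv, h, mul_pow, norm_pow_lpPlane hp0]
  set S := criticalSlopes p (‖T‖ ^ p) (T (e 0) 0) (T (e 1) 0) (T (e 0) 1) (T (e 1) 1)
  have hsub : normAttainmentSet T ⊆ candidates p S := by
    rintro v ⟨hv, hvT⟩
    refine mem_candidates hp0 hv fun h0 h1 =>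
      mem_criticalSlopes hp hN hle hne (div_ne_zero h0 h1) ?_
    have hscale (a b : ℝ) : |a * (v 0 / v 1) + b| ^ p = |a * v 0 + b * v 1| ^ p / |v 1| ^ p := by
      rw [← div_pow, ← abs_div]
      congr 2
      field_simp
    have h1p : |v 1| ^ p ≠ 0 := pow_ne_zero _ (abs_ne_zero.2 h1)
    have hnorm := norm_pow_lpPlane hp0 v
    rw [hv, one_pow] at hnorm
    rw [hscale, hscale, ← add_div, ← hTv, hvT, abs_div, div_pow, ← div_self h1p, ← add_div,
      ← hnorm, mul_one_div]
  refine ⟨(candidates p S).finite_toSet.subset hsub, ?_⟩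
  calc (normAttainmentSet T).ncard ≤ (candidates p S).card := by
        rw [← Set.ncard_coe_finset]
        exact Set.ncard_le_ncard hsub (Finset.finite_toSet _)
    _ ≤ 4 + 2 * S.card := card_candidates_le S
    _ ≤ 4 + 2 * (8 * (p - 1)) := by gcongr; exact card_criticalSlopes_le ..
    _ = 4 * (4 * p - 3) := by omega
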